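/- Let $0\le d\le N$ be integers, let $\mathcal H$ be a complex Hilbert space with orthonormal basis $e_1,\dots,e_N$, and let $S(d)$ be the symmetric group on $\{1,\dots,d\}$. For $\pi\in S(d)$ let $A_\pi\in\operatorname{End}\mathcal H^{\otimes d}$ be the operator $A_\pi(v_1\otimes\cdots\otimes v_d)=v_{\pi(1)}\otimes\cdots\otimes v_{\pi(d)}$ (these operators are invariant under conjugation by $g^{\otimes d}$, $g\in U(N)$), and equip $\operatorname{End}\mathcal H^{\otimes d}$ with the Hilbert–Schmidt scalar product $\langle A,B\rangle=\operatorname{Tr}A^*B$. Then the Gram matrix of the $A_\pi$ is $$\big[\langle A_\rho,A_\sigma\rangle\big]_{\rho,\sigma\in S(d)}=\big[N^{\#\mathrm{cycles}(\rho^{-1}\sigma)}\big]_{\rho,\sigma\in S(d)},$$ where $\#\mathrm{cycles}(\pi)$ is the number of cycles of $\pi$, fixed points included, and this matrix is invertible. Its inverse $W$, the Weingarten matrix, has the entries $$W_{\rho\sigma}=\sum_{\lambda\vdash d}\frac{\chi^\lambda(\rho^{-1}\sigma)}{\prod_{\Box\in\lambda}(N+c(\Box))}\,\frac{\dim V^\lambda}{d!},\qquad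 \rho,\sigma\in S(d).$$ Here $\lambda$ runs over the partitions of $d$, identified with Young diagrams with $d$ cells; $c(\Box)$ is the content (column index minus row index) of the cell $\Box$; $V^\lambda$ is the irreducible complex representation of $S(d)$ indexed by $\lambda$, realized as the left ideal $\mathbb C S(d)\,c_\lambda$ generated by the Young symmetrizer $c_\lambda=\big(\sum_{p}p\big)\big(\sum_{q}\operatorname{sgn}(q)\,q\big)$, where $p$ runs over the permutations preserving the rows and $q$ over those preserving the columns of the tableau of shape $\lambda$ filled row by row with $1,\dots,d$; and $\chi^\lambda$ is the character of $V^\lambda$. In particular $W_{\rho\sigma}$ depends only on the cycle type of $\rho^{-1}\sigma$: there is a unique function $\mathrm{Wg}^{U(N)}$ on the partitions of $d$ (the unitary Weingarten function) such that $W_{\rho\sigma}=\mathrm{Wg}^{U(N)}(\alpha)$ whenever $\rho^{-1}\sigma$ has cycle type $\alpha$. -/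

import Mathlib

open scoped TensorProduct

noncomputable section

namespace Weingarten

/-! ### Permutations: cycle type and number of cycles (fixed points are cycles of length one) -/

/-- The cycle type of a permutation of `d` symbols, as a partition of `d`. -/
def cycleTypePartition {d : ℕ} (π : Equiv.Perm (Fin d)) : d.Partition where
  parts := π.partition.parts
  parts_pos := π.partition.parts_pos
  parts_sum := π.partition.parts_sum.trans (Fintype.card_fin d)

/-- The number of factors in the disjoint cycle decomposition, fixed points included. -/
def numCycles {d : ℕ} (π : Equiv.Perm (Fin d)) : ℕ :=
  Multiset.card (cycleTypePartition π).parts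

/-! ### The operators permuting tensor factors, their Gram matrix, the Weingarten matrix -/

section Gram

variable {H : Type*} [NormedAddCommGroup H] [InnerProductSpace ℂ H] {N : ℕ}

variable (H) in
/-- The operator `A_π (v₁ ⊗ ⋯ ⊗ v_d) = v_{π(1)} ⊗ ⋯ ⊗ v_{π(d)}` on `H^{⊗d}`. -/
def permOp {d : ℕ} (π : Equiv.Perm (Fin d)) :
    (⨂[ℂ] _ : Fin d, H) →ₗ[ℂ] (⨂[ℂ] _ : Fin d, H) :=
  (PiTensorProduct.reindex ℂ (fun _ : Fin d => H) π.symm).toLinearMap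

theorem permOp_tprod {d : ℕ} (π : Equiv.Perm (Fin d)) (v : Fin d → H) :
    permOp H π (PiTensorProduct.tprod ℂ v) = PiTensorProduct.tprod ℂ (fun k => v (π k)) := by
  simp [permOp]

/-- The basis `e_i = e_{i(1)} ⊗ ⋯ ⊗ e_{i(d)}` of `H^{⊗d}` indexed by functions `i : [d] → [N]`.
It is orthonormal for the scalar product of `H^{⊗d}`. -/
def tensorBasis (e : OrthonormalBasis (Fin N) ℂ H) (d : ℕ) :
    Module.Basis (Fin d → Fin N) ℂ (⨂[ℂ] _ : Fin d, H) :=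
  Basis.piTensorProduct (fun _ : Fin d => e.toBasis)

/-- The Hilbert–Schmidt scalar product `⟨A, B⟩ = Tr A^* B` on `End H^{⊗d}`; the adjoint is the
conjugate transpose in the orthonormal basis `e_i`. -/
def hilbertSchmidt (e : OrthonormalBasis (Fin N) ℂ H) {d : ℕ}
    (A B : (⨂[ℂ] _ : Fin d, H) →ₗ[ℂ] (⨂[ℂ] _ : Fin d, H)) : ℂ :=
  Matrix.trace
    ((LinearMap.toMatrix (tensorBasis e d) (tensorBasis e d) A).conjTranspose *
      LinearMap.toMatrix (tensorBasis e d) (tensorBasis e d) B)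

/-- The Gram matrix `[⟨A_ρ, A_σ⟩]` of the invariants `A_π`, `π ∈ S(d)`. -/
def gramMatrix (e : OrthonormalBasis (Fin N) ℂ H) (d : ℕ) :
    Matrix (Equiv.Perm (Fin d)) (Equiv.Perm (Fin d)) ℂ :=
  Matrix.of fun ρ σ => hilbertSchmidt e (permOp H ρ) (permOp H σ)

/-- The Weingarten matrix of the invariants `A_π`, `π ∈ S(d)`: the inverse Gram matrix. -/
def weingartenMatrix (e : OrthonormalBasis (Fin N) ℂ H) (d : ℕ) :
    Matrix (Equiv.Perm (Fin d)) (Equiv.Perm (Fin d)) ℂ :=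
  (gramMatrix e d)⁻¹

end Gram

/-! ### Young diagrams -/

/-- The Young diagram whose row lengths are the parts of `lam` in weakly decreasing order. -/
def diagram {d : ℕ} (lam : d.Partition) : YoungDiagram :=
  YoungDiagram.ofRowLens (lam.parts.sort (· ≥ ·)) (Multiset.pairwise_sort _ _).sortedGE

theorem card_cellsOfRowLens (w : List ℕ) :
    (YoungDiagram.cellsOfRowLens w).card = w.sum := by
  induction w with
  | nil => simp [YoungDiagram.cellsOfRowLens]
  | cons a w ih =>
    rw [YoungDiagram.cellsOfRowLens, Finset.card_union_of_disjoint]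
    · simp [ih]
    · rw [Finset.disjoint_left]
      rintro ⟨i, j⟩ h1 h2
      simp at h1 h2
      omega

theorem card_diagram {d : ℕ} (lam : d.Partition) : (diagram lam).cells.card = d := by
  have h : (diagram lam).cells.card = (lam.parts.sort (· ≥ ·)).sum := card_cellsOfRowLens _
  rw [h, ← Multiset.sum_coe, Multiset.sort_eq, lam.parts_sum]

/-- The content of a cell `(row, column)`: column index minus row index. -/
def content (c : ℕ × ℕ) : ℤ := (c.2 : ℤ) - (c.1 : ℤ)

/-- The tableau of shape `lam` filled with the symbols of `Fin d` in increasing order, row by row: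
the symbol `k` stands in the `k`-th cell for the lexicographic order on pairs `(row, column)`. -/
def tableau {d : ℕ} (lam : d.Partition) (k : Fin d) : ℕ × ℕ :=
  ofLex (((diagram lam).cells.map toLex.toEmbedding).orderEmbOfFin
    ((Finset.card_map _).trans (card_diagram lam)) k)

/-! ### The irreducible representation of the symmetric group indexed by a Young diagram -/

/-- The permutations that preserve each row of the tableau. -/
def rowStabilizer {d : ℕ} (lam : d.Partition) : Finset (Equiv.Perm (Fin d)) :=
  {π | ∀ k, (tableau lam (π k)).1 = (tableau lam k).1}

/-- The permutations that preserve each column of the tableau. -/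
def colStabilizer {d : ℕ} (lam : d.Partition) : Finset (Equiv.Perm (Fin d)) :=
  {π | ∀ k, (tableau lam (π k)).2 = (tableau lam k).2}

/-- The Young symmetrizer `c_λ = (∑_{p ∈ Row} p) (∑_{q ∈ Col} sgn(q) q)` in `ℂ S(d)`. -/
def youngSymmetrizer {d : ℕ} (lam : d.Partition) : MonoidAlgebra ℂ (Equiv.Perm (Fin d)) :=
  (∑ p ∈ rowStabilizer lam, MonoidAlgebra.single p 1) *
    ∑ q ∈ colStabilizer lam, MonoidAlgebra.single q ((Equiv.Perm.sign q : ℤ) : ℂ)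

/-- The irreducible module `V^λ`: the left ideal of `ℂ S(d)` generated by the Young symmetrizer. -/
abbrev irrep {d : ℕ} (lam : d.Partition) :
    Submodule (MonoidAlgebra ℂ (Equiv.Perm (Fin d))) (MonoidAlgebra ℂ (Equiv.Perm (Fin d))) :=
  Submodule.span _ {youngSymmetrizer lam}

/-- The action `R^λ` of `S(d)` on `V^λ` by left multiplication. -/
def irrepAction {d : ℕ} (lam : d.Partition) :
    Representation ℂ (Equiv.Perm (Fin d)) (irrep lam) :=
  Representation.ofModule' (irrep lam)

/-- The irreducible character `χ^λ`. -/
def irrepChar {d : ℕ} (lam : d.Partition) (π : Equiv.Perm (Fin d)) : ℂ :=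
  (irrepAction lam).character π

/-- The dimension of `V^λ`. -/
def irrepDim {d : ℕ} (lam : d.Partition) : ℕ :=
  Module.finrank ℂ (irrep lam)

end Weingarten

end

/-!
A matrix with entries `f (ρ⁻¹ σ)` represents the element `∑ π, f π • π` of the group algebra. For
the Gram matrix this element is `∑ π, N ^ #cycles(π) • π`, which factors as `∏ k, (N + X k)` over
the Jucys–Murphy elements `X k = ∑ y < k, (y k)`. Reading the tableau of `λ` symbol by symbol, `X k`
acts between the row and the column sums of the Young symmetrizer `c_λ` as the content of the `k`-th
cell, so the Gram element multiplies `c_λ` by `∏ □, (N + c(□))`. As a polynomial in `N` this product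
determines `λ`, hence `c_λ x c_μ = 0` for `λ ≠ μ`. Since moreover `c_λ x c_λ` is a multiple of `c_λ`
and there are as many partitions as conjugacy classes, the sums of the conjugates of the `c_λ` span
the centre and diagonalize multiplication by the Gram element; inverting the eigenvalues gives the
formula.
-/

noncomputable section

namespace Weingarten

open MonoidAlgebra

/-! ### The centre of a group algebra -/

section GroupAlgebra

variable {R k G : Type*} [CommRing R] [Field k] [Group G]

theorem mem_center_iff_commute_single {x : R[G]} :
    x ∈ Subalgebra.center R R[G] ↔ ∀ g, Commute (single g 1) x := by
  rw [Subalgebra.mem_center_iff]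
  refine ⟨fun h g => h _, fun h y => ?_⟩
  induction y using MonoidAlgebra.induction_linear with
  | zero => rw [zero_mul, mul_zero]
  | add y₁ y₂ h₁ h₂ => rw [add_mul, mul_add, h₁, h₂]
  | single g a =>
    rw [← smul_of, of_apply, smul_mul_assoc, mul_smul_comm, (h g).eq]

theorem mem_center_iff_coeff_eq_of_isConj {x : R[G]} :
    x ∈ Subalgebra.center R R[G] ↔ ∀ g h, IsConj g h → x.coeff g = x.coeff h := by
  have commute_iff (g : G) : Commute (single g 1) x ↔ ∀ h, x.coeff h = x.coeff (g * h * g⁻¹) := by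
    rw [commute_iff_eq, MonoidAlgebra.ext_iff, Finsupp.ext_iff, (Equiv.mulLeft g).surjective.forall]
    simp only [Equiv.coe_mulLeft, coeff_single_mul_apply, coeff_mul_single_apply, one_mul,
      mul_one, inv_mul_cancel_left]
  simp only [mem_center_iff_commute_single, commute_iff, isConj_iff]
  exact ⟨fun h g _ ⟨a, ha⟩ => ha ▸ h a g, fun h a g => h g _ ⟨a, rfl⟩⟩

theorem finrank_center_le [Finite G] : Module.finrank k (Subalgebra.center k k[G]) ≤
    Nat.card (ConjClasses G) := by
  classical
  have := Fintype.ofFinite G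
  let f : Subalgebra.center k k[G] →ₗ[k] ConjClasses G → k :=
    { toFun := fun x C => x.1.coeff C.out
      map_add' := fun x y => rfl
      map_smul' := fun a x => rfl }
  have hf : Function.Injective f := by
    intro x y hxy
    refine Subtype.ext (MonoidAlgebra.ext (Finsupp.ext fun g => ?_))
    have hg : IsConj g (ConjClasses.mk g).out := ConjClasses.mk_eq_mk_iff_isConj.1
      (Quotient.out_eq _).symm
    rw [mem_center_iff_coeff_eq_of_isConj.1 x.2 _ _ hg,
      mem_center_iff_coeff_eq_of_isConj.1 y.2 _ _ hg]
    exact congrFun hxy (ConjClasses.mk g)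
  have hle := LinearMap.finrank_le_finrank_of_injective hf
  rwa [Module.finrank_fintype_fun_eq_card, ← Nat.card_eq_fintype_card] at hle

section ConjSum

variable [Fintype G]

/-- The sum of all conjugates `g u g⁻¹` of an element `u` of the group algebra; up to the factor
`|G|` this is the projection of `u` onto the centre. -/
def conjSum (u : R[G]) : R[G] := ∑ g, single g 1 * u * single g⁻¹ 1

theorem coeff_conjSum (u : R[G]) (h : G) :
    (conjSum u).coeff h = ∑ g, u.coeff (g⁻¹ * h * g) := by
  simp only [conjSum, coeff_sum, Finsupp.finsetSum_apply, coeff_mul_single_apply,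
    coeff_single_mul_apply, one_mul, mul_one, inv_inv, mul_assoc]

theorem conjSum_mem_center (u : R[G]) : conjSum u ∈ Subalgebra.center R R[G] := by
  refine mem_center_iff_coeff_eq_of_isConj.2 fun g h hgh => ?_
  obtain ⟨a, rfl⟩ := isConj_iff.1 hgh
  rw [coeff_conjSum, coeff_conjSum]
  refine Fintype.sum_equiv (Equiv.mulLeft a) _ _ fun b => congrArg u.coeff ?_
  rw [Equiv.coe_mulLeft]
  group

theorem trace_mulLeft_comp_mulRight (u : R[G]) (g : G) :
    LinearMap.trace R R[G] (LinearMap.mulLeft R (single g 1) ∘ₗ LinearMap.mulRight R u) =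
      (conjSum u).coeff g⁻¹ := by
  classical
  rw [LinearMap.trace_eq_matrix_trace R (MonoidAlgebra.basis G R), coeff_conjSum]
  refine Finset.sum_congr rfl fun h _ => ?_
  rw [Matrix.diag_apply, LinearMap.toMatrix_apply]
  change (single g 1 * (single h 1 * u)).coeff h = _
  rw [coeff_single_mul_apply, coeff_single_mul_apply, one_mul, one_mul, mul_assoc]

theorem conjSum_mul_eq_zero {b c : R[G]} (h : ∀ x, b * x * c = 0) : conjSum b * c = 0 := by
  simp only [conjSum, Finset.sum_mul, mul_assoc] at h ⊢
  simp only [h, mul_zero, Finset.sum_const_zero]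

end ConjSum

/-! ### Idempotents up to a scalar -/

/-- The element `c` is a primitive idempotent of `k[G]` up to a scalar factor: `c k[G] c = k c`.
The normalisation `c(1) = 1` is that of Young symmetrizers. -/
structure IsPrimitiveUpToScalar (c : k[G]) : Prop where
  coeff_one : c.coeff 1 = 1
  exists_smul (x : k[G]) : ∃ a : k, c * x * c = a • c

/-- The scalar `n` such that `c² = n c`, for `c` a scalar multiple of an idempotent with
`c(1) = 1`. -/
def idemScalar (c : R[G]) : R := (c * c).coeff 1

/-- The representation of `G` on the left ideal `k[G] c`. -/
abbrev leftIdealRep (c : k[G]) : Representation k G (Submodule.span k[G] {c}) :=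
  Representation.ofModule' _

namespace IsPrimitiveUpToScalar

variable {c : k[G]}

theorem mul_mul_self (hc : IsPrimitiveUpToScalar c) (x : k[G]) :
    c * x * c = (c * x * c).coeff 1 • c := by
  obtain ⟨a, ha⟩ := hc.exists_smul x
  rw [ha, coeff_smul_apply, hc.coeff_one, smul_eq_mul, mul_one]

theorem mul_self (hc : IsPrimitiveUpToScalar c) : c * c = idemScalar c • c := by
  have := hc.mul_mul_self 1
  rwa [mul_one] at this

theorem idemScalar_mul_character [Fintype G] (hc : IsPrimitiveUpToScalar c) (g : G) :
    idemScalar c * (leftIdealRep c).character g = (conjSum c).coeff g⁻¹ := by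
  let incl : Submodule.span k[G] {c} →ₗ[k] k[G] :=
    (Submodule.span k[G] {c}).subtype.restrictScalars k
  let proj : k[G] →ₗ[k] Submodule.span k[G] {c} :=
    ((LinearMap.toSpanSingleton _ _ c).codRestrict _ fun x =>
      Submodule.smul_mem _ x (Submodule.mem_span_singleton_self c)).restrictScalars k
  have : Module.Finite k k[G] := Module.Finite.of_basis (MonoidAlgebra.basis G k)
  have : Module.Finite k (Submodule.span k[G] {c}) :=
    Module.Finite.of_injective incl Subtype.val_injective
  have proj_incl : proj ∘ₗ incl = idemScalar c • LinearMap.id := by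
    ext ⟨y, hy⟩ : 2
    obtain ⟨x, rfl⟩ := Submodule.mem_span_singleton.1 hy
    change x * c * c = idemScalar c • (x * c)
    rw [mul_assoc, hc.mul_self, mul_smul_comm]
  have incl_proj : incl ∘ₗ (leftIdealRep c g ∘ₗ proj) =
      LinearMap.mulLeft k (single g 1) ∘ₗ LinearMap.mulRight k c :=
    LinearMap.ext fun x => rfl
  rw [← trace_mulLeft_comp_mulRight, ← incl_proj, LinearMap.trace_comp_comm',
    LinearMap.comp_assoc, proj_incl, LinearMap.comp_smul, LinearMap.comp_id, map_smul, smul_eq_mul]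
  rfl

theorem idemScalar_mul_finrank [Finite G] (hc : IsPrimitiveUpToScalar c) :
    idemScalar c * Module.finrank k (Submodule.span k[G] {c}) = Nat.card G := by
  have := Fintype.ofFinite G
  rw [← Representation.char_one (leftIdealRep c), hc.idemScalar_mul_character, coeff_conjSum]
  simp only [inv_one, mul_one, inv_mul_cancel, hc.coeff_one, Finset.sum_const, Finset.card_univ,
    nsmul_eq_mul, Nat.card_eq_fintype_card]

theorem idemScalar_ne_zero [Finite G] [NeZero (Nat.card G : k)]
    (hc : IsPrimitiveUpToScalar c) : idemScalar c ≠ 0 :=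
  left_ne_zero_of_mul (hc.idemScalar_mul_finrank ▸ NeZero.ne (Nat.card G : k))

theorem mul_eq_smul_of_mem_center [Finite G] [NeZero (Nat.card G : k)]
    (hc : IsPrimitiveUpToScalar c) {z : k[G]} (hz : z ∈ Subalgebra.center k k[G]) :
    z * c = (z * c).coeff 1 • c := by
  have hzc : idemScalar c • (z * c) = (c * z * c).coeff 1 • c := by
    rw [← hc.mul_mul_self, Subalgebra.mem_center_iff.1 hz c, mul_assoc, hc.mul_self, mul_smul_comm]
  rw [← inv_smul_smul₀ hc.idemScalar_ne_zero (z * c), hzc, smul_smul, coeff_smul_apply,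
    hc.coeff_one, smul_eq_mul, mul_one]

theorem conjSum_mul_self [Fintype G] [NeZero (Nat.card G : k)] (hc : IsPrimitiveUpToScalar c) :
    conjSum c * c = idemScalar c ^ 2 • c := by
  have coeff_term (g : G) : (single g 1 * c * single g⁻¹ 1 * c).coeff 1 =
      (c * single g⁻¹ (c.coeff g⁻¹) * c).coeff 1 := by
    rw [← smul_of g⁻¹ (c.coeff g⁻¹), of_apply, mul_smul_comm, smul_mul_assoc, mul_assoc, mul_assoc,
      ← mul_assoc c, hc.mul_mul_self, mul_smul_comm]
    simp only [coeff_smul_apply, coeff_single_mul_apply, hc.coeff_one, smul_eq_mul, mul_one,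
      one_mul, mul_comm]
  have coeff_one : (conjSum c * c).coeff 1 = idemScalar c ^ 2 :=
    calc (conjSum c * c).coeff 1
        = ∑ g : G, (c * single g⁻¹ (c.coeff g⁻¹) * c).coeff 1 := by
          rw [conjSum, Finset.sum_mul, coeff_sum, Finsupp.finsetSum_apply]
          exact Finset.sum_congr rfl fun g _ => coeff_term g
      _ = ∑ g : G, (c * single g (c.coeff g) * c).coeff 1 :=
          Equiv.sum_comp (Equiv.inv G) fun g => (c * single g (c.coeff g) * c).coeff 1
      _ = (c * c * c).coeff 1 := by
          rw [← Finsupp.finsetSum_apply, ← coeff_sum, ← Finset.sum_mul, ← Finset.mul_sum,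
            ← Finsupp.sum_fintype c.coeff _ fun g => single_zero g, sum_coeff_single]
      _ = idemScalar c ^ 2 := by
          rw [hc.mul_self, smul_mul_assoc, coeff_smul_apply, ← idemScalar, smul_eq_mul, sq]
  rw [hc.mul_eq_smul_of_mem_center (conjSum_mem_center c), coeff_one]

end IsPrimitiveUpToScalar

/-! ### Central elements in terms of a complete orthogonal family -/

section CompleteFamily

variable {ι : Type*} {c : ι → k[G]}

theorem sum_smul_conjSum_mem_center [Fintype G] [Fintype ι] (b : ι → k) (c : ι → k[G]) :
    ∑ i, b i • conjSum (c i) ∈ Subalgebra.center k k[G] :=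
  sum_mem fun i _ => Subalgebra.smul_mem _ (conjSum_mem_center (c i)) (b i)

variable [NeZero (Nat.card G : k)]

theorem sum_smul_conjSum_mul [Fintype G] [Fintype ι]
    (hc : ∀ i, IsPrimitiveUpToScalar (c i))
    (orth : ∀ i j, i ≠ j → ∀ x, c i * x * c j = 0) (b : ι → k) (j : ι) :
    (∑ i, (b i / idemScalar (c i) ^ 2) • conjSum (c i)) * c j = b j • c j := by
  rw [Finset.sum_mul, Finset.sum_eq_single j]
  · rw [smul_mul_assoc, (hc j).conjSum_mul_self, smul_smul,
      div_mul_cancel₀ _ (pow_ne_zero 2 (hc j).idemScalar_ne_zero)]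
  · intro i _ hij
    rw [smul_mul_assoc, conjSum_mul_eq_zero (orth i j hij), smul_zero]
  · exact fun hj => absurd (Finset.mem_univ j) hj

/-- The dimension count behind completeness: the centre has dimension at most the number of
conjugacy classes, and it surjects onto the functions on `ι`. -/
theorem eq_of_mul_eq_of_mem_center [Finite G] [Finite ι]
    (hc : ∀ i, IsPrimitiveUpToScalar (c i))
    (orth : ∀ i j, i ≠ j → ∀ x, c i * x * c j = 0)
    (card_le : Nat.card (ConjClasses G) ≤ Nat.card ι) {x y : k[G]}
    (hx : x ∈ Subalgebra.center k k[G]) (hy : y ∈ Subalgebra.center k k[G])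
    (hxy : ∀ i, x * c i = y * c i) : x = y := by
  have := Fintype.ofFinite G
  have := Fintype.ofFinite ι
  have : Module.Finite k k[G] := Module.Finite.of_basis (MonoidAlgebra.basis G k)
  let f : Subalgebra.center k k[G] →ₗ[k] ι → k :=
    { toFun := fun z i => (z.1 * c i).coeff 1
      map_add' := fun z w => funext fun i => by
        simp [add_mul]
      map_smul' := fun a z => funext fun i => by
        simp }
  have surj : Function.Surjective f := fun b => by
    refine ⟨⟨_, sum_smul_conjSum_mem_center (fun i => b i / idemScalar (c i) ^ 2) c⟩,
      funext fun j => ?_⟩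
    change (_ * c j).coeff 1 = b j
    rw [sum_smul_conjSum_mul hc orth, coeff_smul_apply, (hc j).coeff_one, smul_eq_mul, mul_one]
  have finrank_eq : Module.finrank k (Subalgebra.center k k[G]) = Module.finrank k (ι → k) := by
    refine le_antisymm (finrank_center_le.trans ?_)
      (LinearMap.finrank_le_finrank_of_surjective surj)
    rwa [Module.finrank_fintype_fun_eq_card, ← Nat.card_eq_fintype_card]
  have inj := (LinearMap.injective_iff_surjective_of_finrank_eq_finrank finrank_eq).2 surj
  exact congrArg Subtype.val (@inj ⟨x, hx⟩ ⟨y, hy⟩ (funext fun i => by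
    change (x * c i).coeff 1 = (y * c i).coeff 1
    rw [hxy]))

theorem exists_mul_eq_one_of_mul_eq_smul [Finite G] [Fintype ι]
    (hc : ∀ i, IsPrimitiveUpToScalar (c i))
    (orth : ∀ i j, i ≠ j → ∀ x, c i * x * c j = 0)
    (card_le : Nat.card (ConjClasses G) ≤ Nat.card ι) {z : k[G]}
    (hz : z ∈ Subalgebra.center k k[G]) {a : ι → k} (ha : ∀ i, a i ≠ 0)
    (hza : ∀ i, z * c i = a i • c i) :
    ∃ w ∈ Subalgebra.center k k[G], z * w = 1 ∧ ∀ g, w.coeff g⁻¹ = ∑ i,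
      (leftIdealRep (c i)).character g / a i *
        (Module.finrank k (Submodule.span k[G] {c i}) / Nat.card G) := by
  have := Fintype.ofFinite G
  set w := ∑ i, ((a i)⁻¹ / idemScalar (c i) ^ 2) • conjSum (c i)
  have w_mem : w ∈ Subalgebra.center k k[G] := sum_smul_conjSum_mem_center _ c
  have w_mul (j : ι) : w * c j = (a j)⁻¹ • c j := sum_smul_conjSum_mul hc orth _ j
  refine ⟨w, w_mem, ?_, fun g => ?_⟩
  · refine eq_of_mul_eq_of_mem_center hc orth card_le (mul_mem hz w_mem) (one_mem _) fun i => ?_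
    rw [mul_assoc, w_mul, mul_smul_comm, hza, smul_smul, inv_mul_cancel₀ (ha i), one_smul, one_mul]
  · rw [coeff_sum, Finsupp.finsetSum_apply]
    refine Finset.sum_congr rfl fun i _ => ?_
    have n_ne := (hc i).idemScalar_ne_zero
    have dim_ne : (Module.finrank k (Submodule.span k[G] {c i}) : k) ≠ 0 :=
      right_ne_zero_of_mul ((hc i).idemScalar_mul_finrank ▸ NeZero.ne (Nat.card G : k))
    rw [coeff_smul_apply, ← (hc i).idemScalar_mul_character, ← (hc i).idemScalar_mul_finrank,
      smul_eq_mul]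
    field_simp

end CompleteFamily

end GroupAlgebra

/-! ### Convolution matrices and twisted subgroup sums -/

section SubgroupSums

variable {R k G : Type*} [CommRing R] [Field k] [Group G]

/-- The matrix of right convolution by `x` in the basis `G` of the group algebra. -/
def coeffMatrix (x : R[G]) : Matrix G G R := Matrix.of fun g h => x.coeff (g⁻¹ * h)

theorem coeffMatrix_one [DecidableEq G] : coeffMatrix (1 : R[G]) = 1 := by
  ext g h
  simp only [coeffMatrix, Matrix.of_apply, one_def, coeff_single, Finsupp.single_apply,
    Matrix.one_apply, inv_mul_eq_one, eq_comm (a := (1 : G))]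

theorem coeffMatrix_mul [Fintype G] (x y : R[G]) :
    coeffMatrix (x * y) = coeffMatrix x * coeffMatrix y := by
  ext g h
  rw [coeffMatrix, Matrix.of_apply, coeff_mul_apply_left,
    Finsupp.sum_fintype _ _ fun _ => zero_mul _, Matrix.mul_apply]
  refine Fintype.sum_equiv (Equiv.mulLeft g) _ _ fun a => ?_
  simp only [coeffMatrix, Matrix.of_apply, Equiv.coe_mulLeft, inv_mul_cancel_left, mul_inv_rev,
    mul_assoc]

/-- The sum `∑ χ(h) h` over the elements `h` of the subgroup `H`, for a linear character `χ`. -/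
def charSum (χ : G →* R) (H : Subgroup G) [Fintype H] : R[G] := ∑ h : H, single (h : G) (χ h)

variable (χ : G →* R) (H : Subgroup G) [Fintype H]

theorem single_mul_charSum {h : G} (hh : h ∈ H) :
    single h (χ h) * charSum χ H = charSum χ H := by
  rw [charSum, Finset.mul_sum]
  refine Fintype.sum_equiv (Equiv.mulLeft ⟨h, hh⟩) _ _ fun g => ?_
  rw [single_mul_single, ← map_mul]
  rfl

theorem charSum_mul_single {h : G} (hh : h ∈ H) :
    charSum χ H * single h (χ h) = charSum χ H := by
  rw [charSum, Finset.sum_mul]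
  refine Fintype.sum_equiv (Equiv.mulRight ⟨h, hh⟩) _ _ fun g => ?_
  rw [single_mul_single, ← map_mul]
  rfl

theorem coeff_charSum_mul_charSum_one (ψ : G →* R) {K : Subgroup G} [Fintype K]
    (hHK : Disjoint H K) : (charSum χ H * charSum ψ K).coeff 1 = 1 := by
  classical
  have hone (p : H × K) : (p.1 : G) * p.2 = 1 ↔ p = 1 := by
    rw [← Subgroup.mul_injective_of_disjoint hHK |>.eq_iff, Prod.fst_one, Prod.snd_one,
      OneMemClass.coe_one, OneMemClass.coe_one, mul_one]
  rw [charSum, charSum, Fintype.sum_mul_sum, ← Fintype.sum_prod_type', coeff_sum,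
    Finsupp.finsetSum_apply]
  simp only [single_mul_single, coeff_single, Finsupp.single_apply, hone]
  simp

theorem exists_mul_charSum_eq [CharZero k] (χ : G →* k) {K : Subgroup G} [Fintype K] (hKH : K ≤ H) :
    ∃ u, u * charSum χ K = charSum χ H := by
  have mul_eq : charSum χ H * charSum χ K = (Fintype.card K : k) • charSum χ H := by
    conv_lhs => rw [charSum.eq_1 χ K]
    simp only [Finset.mul_sum, charSum_mul_single χ H (hKH (Subtype.prop _)), Finset.sum_const,
      Finset.card_univ, Nat.cast_smul_eq_nsmul]
  refine ⟨(Fintype.card K : k)⁻¹ • charSum χ H, ?_⟩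
  rw [smul_mul_assoc, mul_eq, inv_smul_smul₀ (Nat.cast_ne_zero.2 Fintype.card_ne_zero)]

theorem exists_charSum_mul_eq [CharZero k] (χ : G →* k) {K : Subgroup G} [Fintype K] (hKH : K ≤ H) :
    ∃ u, charSum χ K * u = charSum χ H := by
  have mul_eq : charSum χ K * charSum χ H = (Fintype.card K : k) • charSum χ H := by
    conv_lhs => rw [charSum.eq_1 χ K]
    simp only [Finset.sum_mul, single_mul_charSum χ H (hKH (Subtype.prop _)), Finset.sum_const,
      Finset.card_univ, Nat.cast_smul_eq_nsmul]
  refine ⟨(Fintype.card K : k)⁻¹ • charSum χ H, ?_⟩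
  rw [mul_smul_comm, mul_eq, inv_smul_smul₀ (Nat.cast_ne_zero.2 Fintype.card_ne_zero)]

theorem charSum_mul_single_mul_charSum_eq_zero (χ ψ : G →* k) {K : Subgroup G} [Fintype K]
    {g h l : G} (hh : h ∈ H) (hl : l ∈ K) (hgl : h * g = g * l) (hne : χ h ≠ ψ l) :
    charSum χ H * single g 1 * charSum ψ K = 0 := by
  set s := charSum χ H * single g 1 * charSum ψ K
  set t := charSum χ H * single (h * g) 1 * charSum ψ K with ht
  have left : s = χ h • t := by
    rw [ht, ← smul_mul_assoc, ← mul_smul_comm, smul_single, smul_eq_mul, mul_one, ← mul_one (χ h),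
      ← single_mul_single, ← mul_assoc, charSum_mul_single χ H hh]
  have right : s = ψ l • t := by
    rw [ht, hgl, ← smul_mul_assoc, ← mul_smul_comm, smul_single, smul_eq_mul, mul_one,
      ← one_mul (ψ l), ← single_mul_single, ← mul_assoc, mul_assoc _ (single l _),
      single_mul_charSum ψ K hl]
  have t_eq : t = 0 := by
    refine (smul_eq_zero_iff_right (sub_ne_zero.2 hne)).1 ?_
    rw [sub_smul, ← left, ← right, sub_self]
  rw [left, t_eq, smul_zero]

theorem mul_mul_eq_zero_of_mem_center {z b c : k[G]} (hz : z ∈ Subalgebra.center k k[G]) {β γ : k}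
    (hb : z * b = β • b) (hc : z * c = γ • c) (hne : β ≠ γ) (x : k[G]) : b * x * c = 0 := by
  refine (smul_eq_zero_iff_right (sub_ne_zero.2 hne)).1 ?_
  have hzc : z * (b * x * c) = b * x * (z * c) := by
    rw [← mul_assoc, ← Subalgebra.mem_center_iff.1 hz, mul_assoc]
  rw [sub_smul, sub_eq_zero, ← smul_mul_assoc, ← smul_mul_assoc, ← hb, mul_assoc z, mul_assoc z,
    hzc, hc, mul_smul_comm]

theorem exists_mul_mul_eq_smul_of_single {u v c : R[G]}
    (h : ∀ g, ∃ a : R, u * single g 1 * v = a • c) (x : R[G]) : ∃ a : R, u * x * v = a • c := by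
  induction x using MonoidAlgebra.induction_linear with
  | zero => exact ⟨0, by rw [mul_zero, zero_mul, zero_smul]⟩
  | add x y hx hy =>
    obtain ⟨a, ha⟩ := hx
    obtain ⟨b, hb⟩ := hy
    exact ⟨a + b, by rw [mul_add, add_mul, ha, hb, add_smul]⟩
  | single g r =>
    obtain ⟨a, ha⟩ := h g
    exact ⟨r * a, by rw [← smul_of, of_apply, mul_smul_comm, smul_mul_assoc, ha, smul_smul]⟩

end SubgroupSums

/-! ### Cycles and fixed colourings -/

section Cycles

open Equiv Equiv.Perm

variable {α C : Type*}

/-- The colourings `f : α → C` that are constant on the cycles of `π`. -/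
abbrev FixedColoring (π : Perm α) (C : Type*) : Type _ := {f : α → C // ∀ x, f (π x) = f x}

theorem sameCycle_setoid_le_ker_iff {π : Perm α} {f : α → C} :
    SameCycle.setoid π ≤ Setoid.ker f ↔ ∀ x, f (π x) = f x := by
  refine ⟨fun h x => h (sameCycle_apply_left.2 (SameCycle.refl π x)), fun h => ?_⟩
  have zpow_apply (n : ℤ) (x : α) : f ((π ^ n) x) = f x := by
    induction n using Int.induction_on with
    | zero => rfl
    | succ n ih => rw [add_comm, zpow_one_add, Perm.mul_apply, h, ih]
    | pred n ih => rw [← ih, ← h, ← Perm.mul_apply, mul_self_zpow, sub_add_cancel]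
  rintro x _ ⟨n, rfl⟩
  exact (zpow_apply n x).symm

/-- A fixed colouring of `π` as a colouring of the set of cycles of `π`. -/
def fixedColoringEquiv (π : Perm α) (C : Type*) :
    FixedColoring π C ≃ (Quotient (SameCycle.setoid π) → C) :=
  (Equiv.subtypeEquivRight fun _ => sameCycle_setoid_le_ker_iff.symm).trans
    (Setoid.liftEquiv (SameCycle.setoid π))

theorem forall_swap_mul_apply_iff [DecidableEq α] {π : Perm α} {x y : α} (hx : π x = x)
    {f : α → C} : (∀ z, f ((swap x y * π) z) = f z) ↔ (∀ z, f (π z) = f z) ∧ f x = f y := by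
  have apply_swap (h : f x = f y) (z : α) : f (swap x y z) = f z := by
    rw [swap_apply_def]
    split_ifs with hzx hzy
    · rw [hzx, h]
    · rw [hzy, h]
    · rfl
  refine ⟨fun h => ?_, fun ⟨hf, hxy⟩ z => (apply_swap hxy _).trans (hf z)⟩
  have hxy : f x = f y := by simpa only [Perm.mul_apply, hx, swap_apply_left] using (h x).symm
  exact ⟨fun z => (apply_swap hxy _).symm.trans (h z), hxy⟩

theorem update_apply_of_fixed [DecidableEq α] {π : Perm α} {x : α} (hx : π x = x) {f : α → C}
    (hf : ∀ z, f (π z) = f z) (a : C) (z : α) :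
    Function.update f x a (π z) = Function.update f x a z := by
  have hπz : π z = x ↔ z = x := by rw [← π.apply_eq_iff_eq (x := z), hx]
  simp only [Function.update_apply, hπz, hf]

/-- Merging the fixed point `x` of `π` into the cycle of `y` amounts to giving up the free choice
of a colour of `x`. -/
def fixedColoringSwapMulEquiv [DecidableEq α] {π : Perm α} {x y : α} (hx : π x = x) (hxy : y ≠ x)
    (C : Type*) : FixedColoring π C ≃ C × FixedColoring (swap x y * π) C where
  toFun f := (f.1 x, ⟨Function.update f.1 x (f.1 y), (forall_swap_mul_apply_iff hx).2
    ⟨update_apply_of_fixed hx f.2 _, by rw [Function.update_self, Function.update_of_ne hxy]⟩⟩)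
  invFun p := ⟨Function.update p.2.1 x p.1,
    update_apply_of_fixed hx ((forall_swap_mul_apply_iff hx).1 p.2.2).1 _⟩
  left_inv f := by
    simp only [Function.update_idem, Function.update_eq_self]
  right_inv := fun ⟨a, f⟩ => by
    have hfxy := ((forall_swap_mul_apply_iff hx).1 f.2).2
    simp only [Function.update_self, Function.update_idem, Function.update_of_ne hxy, ← hfxy,
      Function.update_eq_self]

variable [Fintype α] [DecidableEq α]

/-- A label of the cycle of `π` through `x`: the cycle itself, or its element if `π` fixes `x`. -/
def cycleLabel (π : Perm α) (x : α) : Perm α ⊕ α :=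
  if π x = x then Sum.inr x else Sum.inl (π.cycleOf x)

theorem ker_cycleLabel (π : Perm α) : Setoid.ker (cycleLabel π) = SameCycle.setoid π := by
  refine le_antisymm (fun x y (h : cycleLabel π x = cycleLabel π y) => ?_)
    (sameCycle_setoid_le_ker_iff.2 fun x => ?_)
  · change π.SameCycle x y
    unfold cycleLabel at h
    split_ifs at h with hx hy hy
    · rw [Sum.inr_injective h]
    · by_contra hxy
      have hne : π.cycleOf x y ≠ y := by rwa [Sum.inl_injective h, cycleOf_apply_self]
      exact hne (cycleOf_apply_of_not_sameCycle hxy)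
  · simp only [cycleLabel, apply_eq_iff_eq, cycleOf_self_apply]
    split_ifs with h
    · rw [h]
    · rfl

theorem image_cycleLabel (π : Perm α) :
    Finset.univ.image (cycleLabel π) = π.cycleFactorsFinset.disjSum π.supportᶜ := by
  ext (c | x)
  · simp only [Finset.mem_image, Finset.mem_univ, true_and, Finset.inl_mem_disjSum, cycleLabel]
    constructor
    · rintro ⟨x, hx⟩
      split_ifs at hx with h
      rw [← Sum.inl_injective hx]
      exact cycleOf_mem_cycleFactorsFinset_iff.2 (mem_support.2 h)
    · intro hc
      obtain ⟨x, hx⟩ := (mem_cycleFactorsFinset_iff.1 hc).1.nonempty_support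
      have hπx := mem_support.1 (mem_cycleFactorsFinset_support_le hc hx)
      exact ⟨x, by rw [if_neg hπx, cycle_is_cycleOf hx hc]⟩
  · simp only [Finset.mem_image, Finset.mem_univ, true_and, Finset.inr_mem_disjSum,
      Finset.mem_compl, mem_support, not_not, cycleLabel]
    constructor
    · rintro ⟨y, hy⟩
      split_ifs at hy with h
      rwa [← Sum.inr_injective hy]
    · exact fun h => ⟨x, if_pos h⟩

theorem card_quotient_sameCycle (π : Perm α) :
    Nat.card (Quotient (SameCycle.setoid π)) = Multiset.card π.partition.parts := by
  rw [← ker_cycleLabel, Nat.card_congr (Setoid.quotientKerEquivRange _), ← Set.image_univ,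
    ← Finset.coe_univ, ← Finset.coe_image, image_cycleLabel, Nat.card_coe_set_eq,
    Set.ncard_coe_finset, Finset.card_disjSum, Finset.card_compl, parts_partition,
    Multiset.card_add, Multiset.card_replicate, cycleType_def, Multiset.card_map]
  rfl

theorem card_fixedColoring (π : Perm α) (C : Type*) [Finite C] :
    Nat.card (FixedColoring π C) = Nat.card C ^ Multiset.card π.partition.parts := by
  have := Fintype.ofFinite C
  rw [Nat.card_congr (fixedColoringEquiv π C), Nat.card_fun, card_quotient_sameCycle]

theorem card_parts_partition_swap_mul {π : Perm α} {x y : α} (hx : π x = x) (hxy : y ≠ x) :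
    Multiset.card (swap x y * π).partition.parts + 1 = Multiset.card π.partition.parts := by
  have h := Nat.card_congr (fixedColoringSwapMulEquiv hx hxy Bool)
  rw [Nat.card_prod, card_fixedColoring, card_fixedColoring, ← pow_succ', Nat.card_eq_fintype_card,
    Fintype.card_bool] at h
  exact (Nat.pow_right_injective le_rfl h).symm

theorem card_sub_le_card_parts_partition (π : Perm α) :
    Fintype.card α - π.support.card ≤ Multiset.card π.partition.parts := by
  rw [parts_partition, Multiset.card_add, Multiset.card_replicate]
  exact Nat.le_add_left _ _

end Cycles

section CycleType

variable {d : ℕ} {C : Type*}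

theorem cycleTypePartition_eq_iff {π τ : Equiv.Perm (Fin d)} :
    cycleTypePartition π = cycleTypePartition τ ↔ IsConj π τ := by
  rw [Equiv.Perm.partition_eq_of_isConj, Nat.Partition.ext_iff, Nat.Partition.ext_iff]
  rfl

theorem filter_two_le_parts_add_replicate_one {n : ℕ} (lam : n.Partition) :
    lam.parts.filter (2 ≤ ·) + Multiset.replicate (n - (lam.parts.filter (2 ≤ ·)).sum) 1 =
      lam.parts := by
  have hadd := Multiset.filter_add_not (fun a => 2 ≤ a) lam.parts
  obtain ⟨m, hm⟩ : ∃ m, lam.parts.filter (fun a => ¬2 ≤ a) = Multiset.replicate m 1 := by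
    refine ⟨_, Multiset.eq_replicate_card.2 fun a ha => ?_⟩
    have hpos := lam.parts_pos (Multiset.mem_filter.1 ha).1
    have hlt := (Multiset.mem_filter.1 ha).2
    lia
  rw [hm] at hadd
  have hsum := congrArg Multiset.sum hadd
  rw [Multiset.sum_add, Multiset.sum_replicate, smul_eq_mul, mul_one, lam.parts_sum] at hsum
  rwa [Nat.sub_eq_of_eq_add' hsum.symm]

theorem cycleTypePartition_surjective :
    Function.Surjective (cycleTypePartition : Equiv.Perm (Fin d) → d.Partition) := by
  intro lam
  have hsplit := filter_two_le_parts_add_replicate_one lam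
  have hsum := congrArg Multiset.sum hsplit
  rw [Multiset.sum_add, lam.parts_sum] at hsum
  obtain ⟨π, hπ⟩ := (Equiv.Perm.exists_with_cycleType_iff (Fin d)).2
    ⟨(Nat.le_of_add_right_le hsum.le).trans_eq (Fintype.card_fin d).symm,
      fun a ha => (Multiset.mem_filter.1 ha).2⟩
  refine ⟨π, Nat.Partition.ext ?_⟩
  change π.partition.parts = lam.parts
  rw [Equiv.Perm.parts_partition, ← Equiv.Perm.sum_cycleType, hπ, Fintype.card_fin, hsplit]

theorem card_conjClasses_perm_le (d : ℕ) :
    Nat.card (ConjClasses (Equiv.Perm (Fin d))) ≤ Nat.card d.Partition := by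
  refine Nat.card_le_card_of_injective
    (Quotient.lift cycleTypePartition fun _ _ => cycleTypePartition_eq_iff.2) ?_
  rintro ⟨π⟩ ⟨τ⟩ h
  exact Quotient.sound (cycleTypePartition_eq_iff.1 h)

theorem existsUnique_eq_comp_cycleTypePartition {φ : Equiv.Perm (Fin d) → C}
    (hφ : ∀ π τ, IsConj π τ → φ π = φ τ) :
    ∃! f : d.Partition → C, φ = f ∘ cycleTypePartition := by
  have hfactor : φ.FactorsThrough cycleTypePartition :=
    fun π τ h => hφ π τ (cycleTypePartition_eq_iff.1 h)
  obtain ⟨f, hf⟩ : ∃ f : d.Partition → C, φ = f ∘ cycleTypePartition :=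
    ⟨φ ∘ Function.surjInv cycleTypePartition_surjective,
      funext fun π => hfactor (Function.surjInv_eq _ _).symm⟩
  exact ⟨f, hf, fun f' hf' => cycleTypePartition_surjective.injective_comp_right
    (hf'.symm.trans hf)⟩

end CycleType

/-! ### The Gram matrix -/

section Gram

variable {H : Type*} [NormedAddCommGroup H] [InnerProductSpace ℂ H] {N d : ℕ}

theorem toMatrix_permOp (e : OrthonormalBasis (Fin N) ℂ H) (π : Equiv.Perm (Fin d))
    (i j : Fin d → Fin N) :
    LinearMap.toMatrix (tensorBasis e d) (tensorBasis e d) (permOp H π) j i =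
      if i ∘ π = j then 1 else 0 := by
  have hbasis : permOp H π (tensorBasis e d i) = tensorBasis e d (i ∘ π) := by
    simp only [tensorBasis, Basis.piTensorProduct_apply, permOp_tprod, Function.comp_def]
  rw [LinearMap.toMatrix_apply, hbasis, Module.Basis.repr_self, Finsupp.single_apply]

theorem hilbertSchmidt_permOp (e : OrthonormalBasis (Fin N) ℂ H) (ρ σ : Equiv.Perm (Fin d)) :
    hilbertSchmidt e (permOp H ρ) (permOp H σ) =
      Nat.card {i : Fin d → Fin N // i ∘ ρ = i ∘ σ} := by
  simp only [hilbertSchmidt, Matrix.trace, Matrix.diag_apply, Matrix.mul_apply,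
    Matrix.conjTranspose_apply, toMatrix_permOp, apply_ite star, star_one, star_zero, ite_mul,
    one_mul, zero_mul, Finset.sum_ite_eq, Finset.mem_univ, if_true, eq_comm (b := _ ∘ ρ),
    Finset.sum_boole, Nat.card_eq_fintype_card, Fintype.card_subtype]

theorem gramMatrix_apply (e : OrthonormalBasis (Fin N) ℂ H) (ρ σ : Equiv.Perm (Fin d)) :
    gramMatrix e d ρ σ = (N : ℂ) ^ numCycles (ρ⁻¹ * σ) := by
  have hcomp (i : Fin d → Fin N) :
      i ∘ ρ = i ∘ σ ↔ ∀ x, (i ∘ ρ) ((ρ⁻¹ * σ) x) = (i ∘ ρ) x := by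
    simp only [funext_iff, Function.comp_apply, Equiv.Perm.mul_apply, Equiv.Perm.coe_inv,
      Equiv.apply_symm_apply, eq_comm]
  have hcard : Nat.card {i : Fin d → Fin N // i ∘ ρ = i ∘ σ} =
      Nat.card (FixedColoring (ρ⁻¹ * σ) (Fin N)) :=
    Nat.card_congr ((ρ.symm.arrowCongr (Equiv.refl _)).subtypeEquiv hcomp)
  rw [gramMatrix, Matrix.of_apply, hilbertSchmidt_permOp, hcard, card_fixedColoring, Nat.card_fin,
    Nat.cast_pow]
  rfl

end Gram

/-! ### Jucys–Murphy elements -/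

section JucysMurphy

open Equiv Equiv.Perm

variable {R : Type*} [CommRing R] {d : ℕ}

/-- The copy of `S(k)` in `S(d)` consisting of the permutations of the symbols less than `k`. -/
abbrev permsBelow (d k : ℕ) : Subgroup (Perm (Fin d)) :=
  fixingSubgroup (Perm (Fin d)) {i : Fin d | k ≤ i}

theorem mem_permsBelow {k : ℕ} {π : Perm (Fin d)} :
    π ∈ permsBelow d k ↔ ∀ i : Fin d, k ≤ i → π i = i :=
  mem_fixingSubgroup_iff _

instance (d k : ℕ) : DecidablePred (· ∈ permsBelow d k) :=
  fun _ => decidable_of_iff _ mem_permsBelow.symm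

theorem permsBelow_mono {k l : ℕ} (h : k ≤ l) : permsBelow d k ≤ permsBelow d l :=
  fixingSubgroup_antitone _ _ fun _ => h.trans

theorem apply_lt_of_mem_permsBelow {k : ℕ} {π : Perm (Fin d)} (hπ : π ∈ permsBelow d k)
    {i : Fin d} (hi : i < k) : π i < k := by
  by_contra! h
  exact h.not_gt (by rwa [π.injective (mem_permsBelow.1 hπ _ h)])

theorem swap_mem_permsBelow {k : ℕ} {x y : Fin d} (hx : x < k) (hy : y < k) :
    swap x y ∈ permsBelow d k :=
  mem_permsBelow.2 fun i hi => swap_apply_of_ne_of_ne (by rintro rfl; lia) (by rintro rfl; lia)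

/-- A permutation of the symbols `≤ x` is determined by the image `y` of `x` and the permutation of
the symbols `< x` left after undoing the transposition `(x y)`. -/
def permsBelowSuccEquiv (x : Fin d) :
    permsBelow d (x + 1) ≃ Finset.Iic x × permsBelow d x where
  toFun π :=
    have hπx : π.1 x ≤ x := Nat.le_of_lt_succ (apply_lt_of_mem_permsBelow π.2 (Nat.lt_succ_self x))
    (⟨π.1 x, Finset.mem_Iic.2 hπx⟩, ⟨swap x (π.1 x) * π.1, mem_permsBelow.2 fun i hi => by
      rcases eq_or_ne i x with rfl | hix
      · rw [Perm.mul_apply, swap_apply_right]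
      · have hxi : x < i := lt_of_le_of_ne hi hix.symm
        rw [Perm.mul_apply, mem_permsBelow.1 π.2 i hxi,
          swap_apply_of_ne_of_ne hix (hπx.trans_lt hxi).ne']⟩)
  invFun p := ⟨swap x p.1 * p.2, mul_mem
    (swap_mem_permsBelow (Nat.lt_succ_self x)
      (Nat.lt_succ_of_le (Fin.le_def.1 (Finset.mem_Iic.1 p.1.2))))
    (permsBelow_mono (Nat.le_succ x) p.2.2)⟩
  left_inv π := Subtype.ext (swap_mul_self_mul _ _ _)
  right_inv := fun ⟨y, π⟩ => by
    have hx : (swap x y.1 * π.1) x = y := by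
      rw [Perm.mul_apply, mem_permsBelow.1 π.2 x le_rfl, swap_apply_left]
    simp only [hx, swap_mul_self_mul]

theorem sum_permsBelow_succ {M : Type*} [AddCommMonoid M] (x : Fin d) (f : Perm (Fin d) → M) :
    ∑ π : permsBelow d (x + 1), f π =
      ∑ y ∈ Finset.Iic x, ∑ π : permsBelow d x, f (swap x y * π) := by
  rw [← (permsBelowSuccEquiv x).symm.sum_comp, Fintype.sum_prod_type,
    ← Finset.sum_coe_sort (Finset.Iic x)]
  rfl

/-- The Jucys–Murphy element `∑ (x y)`, the sum over the symbols `y < x`. -/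
def jucysMurphy (x : Fin d) : R[Perm (Fin d)] := ∑ y ∈ Finset.Iio x, single (swap x y) 1

theorem commute_single_jucysMurphy {x : Fin d} {π : Perm (Fin d)} (hπ : π ∈ permsBelow d x)
    (a : R) : Commute (single π a) (jucysMurphy x) := by
  have hπx := mem_permsBelow.1 hπ x le_rfl
  rw [Commute, SemiconjBy, jucysMurphy, Finset.mul_sum, Finset.sum_mul]
  refine Finset.sum_equiv π (fun y => ?_) fun y _ => ?_
  · rw [Finset.mem_Iio, Finset.mem_Iio]
    refine ⟨apply_lt_of_mem_permsBelow hπ, fun h => ?_⟩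
    simpa using apply_lt_of_mem_permsBelow (inv_mem hπ) h
  · rw [single_mul_single, single_mul_single, mul_one, one_mul, mul_swap_eq_swap_mul, hπx]

/-- The sum `∑ z ^ #cycles(π) π` over `S(k)`, as an element of the group algebra of `S(d)`. The
exponent does not count the `d - k` symbols outside of `S(k)`, all of which are fixed by `π`. -/
def cycleSum (d : ℕ) (z : R) (k : ℕ) : R[Perm (Fin d)] :=
  ∑ π : permsBelow d k, single π.1 (z ^ (numCycles π.1 - (d - k)))

theorem sub_le_numCycles {k : ℕ} {π : Perm (Fin d)} (hπ : π ∈ permsBelow d k) :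
    d - k ≤ numCycles π := by
  have hsupport : π.support ⊆ Finset.univ.filter fun i : Fin d => i < k := fun i hi => by
    rw [Finset.mem_filter]
    refine ⟨Finset.mem_univ i, lt_of_not_ge fun h => mem_support.1 hi (mem_permsBelow.1 hπ i h)⟩
  have hcard := Finset.card_le_card hsupport
  rw [Fin.card_filter_val_lt] at hcard
  calc d - k ≤ Fintype.card (Fin d) - π.support.card := by
        rw [Fintype.card_fin]
        exact Nat.sub_le_sub_left (hcard.trans (min_le_right _ _)) d
    _ ≤ numCycles π := card_sub_le_card_parts_partition π

theorem cycleSum_zero (d : ℕ) (z : R) : cycleSum d z 0 = 1 := by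
  have hone : ∀ π : permsBelow d 0, π = 1 := fun π =>
    Subtype.ext (Equiv.ext fun i => mem_permsBelow.1 π.2 i (Nat.zero_le i))
  have hcycles : numCycles (1 : Perm (Fin d)) = d := by
    simp [numCycles, cycleTypePartition, parts_partition]
  rw [cycleSum, Fintype.sum_eq_single 1 fun π hπ => (hπ (hone π)).elim, OneMemClass.coe_one,
    hcycles, Nat.sub_zero, Nat.sub_self, pow_zero, MonoidAlgebra.one_def]

theorem cycleSum_succ (z : R) (x : Fin d) :
    cycleSum d z (x + 1) = (z • 1 + jucysMurphy x) * cycleSum d z x := by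
  have hfixed (π : permsBelow d x) :
      single (swap x x * π.1) (z ^ (numCycles (swap x x * π.1) - (d - (x + 1)))) =
        z • single π.1 (z ^ (numCycles π.1 - (d - x))) := by
    have hle := sub_le_numCycles π.2
    rw [swap_self, ← Perm.one_def, one_mul, smul_single, smul_eq_mul, ← pow_succ']
    congr 2
    lia
  have hmerged {y : Fin d} (hy : y ≠ x) (π : permsBelow d x) :
      single (swap x y * π.1) (z ^ (numCycles (swap x y * π.1) - (d - (x + 1)))) =
        single (swap x y) 1 * single π.1 (z ^ (numCycles π.1 - (d - x))) := by
    have hcycles : numCycles (swap x y * π.1) + 1 = numCycles π.1 :=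
      card_parts_partition_swap_mul (mem_permsBelow.1 π.2 x le_rfl) hy
    rw [single_mul_single, one_mul]
    congr 2
    lia
  rw [cycleSum, sum_permsBelow_succ x fun π => single π (z ^ (numCycles π - (d - (x + 1)))),
    ← Finset.Iio_insert, Finset.sum_insert Finset.notMem_Iio_self, add_mul, smul_one_mul,
    cycleSum, Finset.smul_sum, jucysMurphy, Finset.sum_mul_sum]
  congr 1
  · exact Finset.sum_congr rfl fun π _ => hfixed π
  · exact Finset.sum_congr rfl fun y hy => Finset.sum_congr rfl fun π _ =>
      hmerged (Finset.mem_Iio.1 hy).ne π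

theorem coeff_cycleSum_self (z : R) (π : Perm (Fin d)) :
    (cycleSum d z d).coeff π = z ^ numCycles π := by
  have hmem : π ∈ permsBelow d d := mem_permsBelow.2 fun i hi => (hi.not_gt i.2).elim
  rw [cycleSum, coeff_sum, Finsupp.finsetSum_apply,
    Fintype.sum_eq_single ⟨π, hmem⟩ fun τ hτ => ?_, coeff_single, Finsupp.single_eq_same,
    Nat.sub_self, Nat.sub_zero]
  rw [coeff_single, Finsupp.single_eq_of_ne fun h => hτ (Subtype.ext h.symm)]

theorem cycleSum_mem_center (d : ℕ) (z : R) :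
    cycleSum d z d ∈ Subalgebra.center R R[Perm (Fin d)] := by
  refine mem_center_iff_coeff_eq_of_isConj.2 fun π τ h => ?_
  rw [coeff_cycleSum_self, coeff_cycleSum_self, numCycles, numCycles,
    cycleTypePartition_eq_iff.2 h]

theorem gramMatrix_eq_coeffMatrix {H : Type*} [NormedAddCommGroup H] [InnerProductSpace ℂ H]
    {N : ℕ} (e : OrthonormalBasis (Fin N) ℂ H) :
    gramMatrix e d = coeffMatrix (cycleSum d (N : ℂ) d) := by
  ext ρ σ
  rw [gramMatrix_apply, coeffMatrix, Matrix.of_apply, coeff_cycleSum_self]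

end JucysMurphy

/-! ### The tableau of a partition -/

section Tableau

variable {d : ℕ} (lam : d.Partition)

theorem tableau_strictMono : StrictMono fun k => toLex (tableau lam k) :=
  fun _ _ h => (Finset.orderEmbOfFin _ ((Finset.card_map _).trans (card_diagram lam))).strictMono h

theorem tableau_injective : Function.Injective (tableau lam) :=
  fun _ _ h => (tableau_strictMono lam).injective (congrArg toLex h)

theorem image_tableau : Finset.univ.image (tableau lam) = (diagram lam).cells := by
  refine Finset.coe_injective ?_
  have hrange := Finset.range_orderEmbOfFin _ ((Finset.card_map toLex.toEmbedding).trans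
    (card_diagram lam))
  rw [Finset.coe_image, Finset.coe_univ, Set.image_univ]
  change Set.range (ofLex ∘ _) = _
  rw [Set.range_comp, hrange, Finset.coe_map, Set.image_image]
  exact Set.image_id _

theorem tableau_mem (k : Fin d) : tableau lam k ∈ (diagram lam).cells := by
  rw [← image_tableau]
  exact Finset.mem_image_of_mem _ (Finset.mem_univ k)

theorem prod_cells_eq_prod_tableau {M : Type*} [CommMonoid M] (f : ℕ × ℕ → M) :
    ∏ c ∈ (diagram lam).cells, f c = ∏ k, f (tableau lam k) := by
  rw [← image_tableau, Finset.prod_image (tableau_injective lam).injOn]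

variable {lam}

theorem exists_tableau_eq {c : ℕ × ℕ} (hc : c ∈ (diagram lam).cells) : ∃ k, tableau lam k = c := by
  rw [← image_tableau] at hc
  simpa only [Finset.mem_image, Finset.mem_univ, true_and] using hc

theorem exists_tableau_eq_of_le (x : Fin d) {i j : ℕ} (hi : i ≤ (tableau lam x).1)
    (hj : j ≤ (tableau lam x).2) : ∃ k, tableau lam k = (i, j) :=
  exists_tableau_eq ((diagram lam).up_left_mem hi hj (tableau_mem lam x))

theorem lt_iff_tableau_lt {x y : Fin d} :
    y < x ↔ (tableau lam y).1 < (tableau lam x).1 ∨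
      (tableau lam y).1 = (tableau lam x).1 ∧ (tableau lam y).2 < (tableau lam x).2 := by
  rw [← (tableau_strictMono lam).lt_iff_lt, Prod.Lex.toLex_lt_toLex]

theorem card_filter_row_eq (x : Fin d) :
    ((Finset.Iio x).filter fun y => (tableau lam y).1 = (tableau lam x).1).card =
      (tableau lam x).2 := by
  conv_rhs => rw [← Finset.card_range (tableau lam x).2]
  refine Finset.card_nbij (fun y => (tableau lam y).2) (fun y hy => ?_) (fun y hy z hz h => ?_)
    fun j hj => ?_
  · simp only [Finset.coe_filter, Set.mem_ofPred_eq, Finset.mem_Iio,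
      lt_iff_tableau_lt (lam := lam)] at hy
    exact Finset.mem_range.2 (by lia)
  · simp only [Finset.coe_filter, Set.mem_ofPred_eq] at hy hz
    exact tableau_injective lam (Prod.ext (hy.2.trans hz.2.symm) h)
  · have hjx := Finset.mem_range.1 hj
    obtain ⟨y, hy⟩ := exists_tableau_eq_of_le x le_rfl hjx.le
    refine ⟨y, ?_, congrArg Prod.snd hy⟩
    simp [lt_iff_tableau_lt (lam := lam), hy, hjx]

theorem card_filter_col_eq (x : Fin d) :
    ((Finset.Iio x).filter fun y => (tableau lam y).2 = (tableau lam x).2).card =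
      (tableau lam x).1 := by
  conv_rhs => rw [← Finset.card_range (tableau lam x).1]
  refine Finset.card_nbij (fun y => (tableau lam y).1) (fun y hy => ?_) (fun y hy z hz h => ?_)
    fun i hi => ?_
  · simp only [Finset.coe_filter, Set.mem_ofPred_eq, Finset.mem_Iio,
      lt_iff_tableau_lt (lam := lam)] at hy
    exact Finset.mem_range.2 (by lia)
  · simp only [Finset.coe_filter, Set.mem_ofPred_eq] at hy hz
    exact tableau_injective lam (Prod.ext h (hy.2.trans hz.2.symm))
  · have hix := Finset.mem_range.1 hi
    obtain ⟨y, hy⟩ := exists_tableau_eq_of_le x hix.le le_rfl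
    refine ⟨y, ?_, congrArg Prod.fst hy⟩
    simp [lt_iff_tableau_lt (lam := lam), hy, hix]

theorem row_lt {c : ℕ × ℕ} (hc : c ∈ (diagram lam).cells) : c.1 < d := by
  obtain ⟨x, rfl⟩ := exists_tableau_eq hc
  calc (tableau lam x).1 ≤ (Finset.Iio x).card := by
        rw [← card_filter_col_eq]
        exact Finset.card_filter_le _ _
    _ < d := (Fin.card_Iio x).trans_lt x.2

theorem prod_add_content_ne_zero {N : ℕ} (hd : d ≤ N) :
    ∏ c ∈ (diagram lam).cells, ((N : ℂ) + (content c : ℂ)) ≠ 0 := by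
  refine Finset.prod_ne_zero_iff.2 fun c hc => ?_
  have hrow := row_lt hc
  have hpos : (N : ℤ) + content c ≠ 0 := by
    rw [content]
    lia
  exact_mod_cast hpos

end Tableau

/-! ### The content eigenvalues of the Young symmetrizers -/

section YoungSymmetrizer

open Equiv Equiv.Perm

variable {d : ℕ} {ι : Type*}

/-- The Young subgroup of the permutations of the symbols less than `k` preserving the fibres of
`t`. -/
def youngSubgroup (t : Fin d → ι) (k : ℕ) : Subgroup (Perm (Fin d)) where
  carrier := {π | (∀ i, t (π i) = t i) ∧ π ∈ permsBelow d k}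
  mul_mem' := fun ⟨hπ, hπk⟩ ⟨hτ, hτk⟩ => ⟨fun i => (hπ _).trans (hτ i), mul_mem hπk hτk⟩
  one_mem' := ⟨fun _ => rfl, one_mem _⟩
  inv_mem' := fun {π} ⟨hπ, hπk⟩ =>
    ⟨fun i => (hπ _).symm.trans (congrArg t (π.apply_symm_apply i)), inv_mem hπk⟩

theorem mem_youngSubgroup {t : Fin d → ι} {k : ℕ} {π : Perm (Fin d)} :
    π ∈ youngSubgroup t k ↔ (∀ i, t (π i) = t i) ∧ π ∈ permsBelow d k :=
  Iff.rfl

instance [DecidableEq ι] (t : Fin d → ι) (k : ℕ) : DecidablePred (· ∈ youngSubgroup t k) :=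
  fun _ => decidable_of_iff _ mem_youngSubgroup.symm

theorem youngSubgroup_mono (t : Fin d → ι) {k l : ℕ} (h : k ≤ l) :
    youngSubgroup t k ≤ youngSubgroup t l :=
  fun _ hπ => ⟨hπ.1, permsBelow_mono h hπ.2⟩

theorem swap_mem_youngSubgroup {t : Fin d → ι} {k : ℕ} {x y : Fin d} (hx : x < k) (hy : y < k)
    (ht : t x = t y) : swap x y ∈ youngSubgroup t k := by
  refine ⟨fun i => ?_, swap_mem_permsBelow hx hy⟩
  rw [swap_apply_def]
  split_ifs with hix hiy
  · rw [hix, ht]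
  · rw [hiy, ht]
  · rfl

theorem mem_youngSubgroup_self {t : Fin d → ι} {π : Perm (Fin d)} :
    π ∈ youngSubgroup t d ↔ ∀ i, t (π i) = t i :=
  and_iff_left (mem_permsBelow.2 fun i hi => (hi.not_gt i.2).elim)

/-- The sign as a linear character with values in `ℂ`. -/
def signChar (α : Type*) [Fintype α] [DecidableEq α] : Perm α →* ℂ :=
  (Int.castRingHom ℂ : ℤ →* ℂ).comp ((Units.coeHom ℤ).comp sign)

theorem signChar_apply (π : Perm (Fin d)) : signChar (Fin d) π = ((sign π : ℤ) : ℂ) := rfl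

theorem signChar_swap {x y : Fin d} (h : x ≠ y) : signChar (Fin d) (swap x y) = -1 := by
  rw [signChar_apply, sign_swap h, Units.val_neg, Units.val_one, Int.cast_neg, Int.cast_one]

theorem charSum_commute_jucysMurphy [DecidableEq ι] (χ : Perm (Fin d) →* ℂ) (t : Fin d → ι)
    (x : Fin d) : Commute (charSum χ (youngSubgroup t x)) (jucysMurphy x) :=
  Commute.sum_left _ _ _ fun π _ => commute_single_jucysMurphy π.2.2 _

variable (lam : d.Partition)

/-- The row symmetrizer of the part of the tableau filled with the symbols less than `k`. -/
def rowSum (k : ℕ) : ℂ[Perm (Fin d)] := charSum 1 (youngSubgroup (fun i => (tableau lam i).1) k)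

/-- The column antisymmetrizer of the part of the tableau filled with the symbols less than `k`. -/
def colSum (k : ℕ) : ℂ[Perm (Fin d)] :=
  charSum (signChar (Fin d)) (youngSubgroup (fun i => (tableau lam i).2) k)

theorem youngSymmetrizer_eq_rowSum_mul_colSum :
    youngSymmetrizer lam = rowSum lam d * colSum lam d := by
  have sum_eq (t : Fin d → ℕ) (χ : Perm (Fin d) →* ℂ) :
      ∑ π with ∀ i, t (π i) = t i, single π (χ π) = charSum χ (youngSubgroup t d) := by
    refine Finset.sum_subtype _ (fun π => ?_) _
    rw [Finset.mem_filter_univ, mem_youngSubgroup_self]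
  exact congrArg₂ (· * ·) (sum_eq (fun i => (tableau lam i).1) 1)
    (sum_eq (fun i => (tableau lam i).2) (signChar (Fin d)))

variable {lam}

theorem rowSum_mul_single {k : ℕ} {π : Perm (Fin d)}
    (hπ : π ∈ youngSubgroup (fun i => (tableau lam i).1) k) :
    rowSum lam k * single π 1 = rowSum lam k :=
  charSum_mul_single 1 _ hπ

theorem single_mul_colSum {k : ℕ} {π : Perm (Fin d)}
    (hπ : π ∈ youngSubgroup (fun i => (tableau lam i).2) k) :
    single π (signChar (Fin d) π) * colSum lam k = colSum lam k :=
  single_mul_charSum _ _ hπ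

theorem rowSum_mul_single_mul_colSum_eq_zero {k : ℕ} {σ : Perm (Fin d)} {x y : Fin d} (hxy : x ≠ y)
    (hx : x < k) (hy : y < k) (hσx : σ x < k) (hσy : σ y < k)
    (hrow : (tableau lam (σ x)).1 = (tableau lam (σ y)).1)
    (hcol : (tableau lam x).2 = (tableau lam y).2) :
    rowSum lam k * single σ 1 * colSum lam k = 0 := by
  refine charSum_mul_single_mul_charSum_eq_zero _ _ _ (swap_mem_youngSubgroup hσx hσy hrow)
    (swap_mem_youngSubgroup hx hy hcol) (mul_swap_eq_swap_mul σ x y).symm ?_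
  rw [signChar_swap hxy, MonoidHom.one_apply]
  norm_num

theorem rowSum_mul_swap_mul_colSum {x y : Fin d} (hyx : y < x) :
    rowSum lam (x + 1) * single (swap x y) 1 * colSum lam (x + 1) =
      ((if (tableau lam y).1 = (tableau lam x).1 then 1 else 0 : ℂ) -
        (if (tableau lam y).2 = (tableau lam x).2 then 1 else 0)) •
          (rowSum lam (x + 1) * colSum lam (x + 1)) := by
  have hx : (x : ℕ) < x + 1 := Nat.lt_succ_self _
  have hy : (y : ℕ) < x + 1 := Nat.lt_succ_of_lt hyx
  by_cases hrow : (tableau lam y).1 = (tableau lam x).1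
  · have hcol : (tableau lam y).2 ≠ (tableau lam x).2 := fun hcol =>
      hyx.ne (tableau_injective lam (Prod.ext hrow hcol))
    rw [if_pos hrow, if_neg hcol, sub_zero, one_smul,
      rowSum_mul_single (swap_mem_youngSubgroup hx hy hrow.symm)]
  by_cases hcol : (tableau lam y).2 = (tableau lam x).2
  · have hsingle : single (swap x y) (1 : ℂ) =
        (-1 : ℂ) • single (swap x y) (signChar (Fin d) (swap x y)) := by
      rw [signChar_swap hyx.ne', smul_single, smul_eq_mul, neg_one_mul, neg_neg]
    rw [if_neg hrow, if_pos hcol, zero_sub, mul_assoc, hsingle, smul_mul_assoc,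
      single_mul_colSum (swap_mem_youngSubgroup hx hy hcol.symm), mul_smul_comm]
  · obtain ⟨z, hz⟩ : ∃ z, tableau lam z = ((tableau lam y).1, (tableau lam x).2) :=
      exists_tableau_eq_of_le x (by have := (lt_iff_tableau_lt (lam := lam)).1 hyx; lia) le_rfl
    have hzx : z < x := by
      have := (lt_iff_tableau_lt (lam := lam)).1 hyx
      refine (lt_iff_tableau_lt (lam := lam)).2 (.inl ?_)
      rw [hz]
      lia
    have hzy : z ≠ y := fun h => hcol (by rw [← h, hz])
    have hswap : swap x y z = z := swap_apply_of_ne_of_ne hzx.ne hzy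
    rw [if_neg hrow, if_neg hcol, sub_zero, zero_smul]
    refine rowSum_mul_single_mul_colSum_eq_zero hzx.ne' hx (Nat.lt_succ_of_lt hzx) ?_ ?_ ?_ ?_
    · rwa [swap_apply_left]
    · rw [hswap]
      exact Nat.lt_succ_of_lt hzx
    · rw [swap_apply_left, hswap, hz]
    · rw [hz]

theorem rowSum_mul_jucysMurphy_mul_colSum (x : Fin d) :
    rowSum lam (x + 1) * jucysMurphy x * colSum lam (x + 1) =
      (content (tableau lam x) : ℂ) • (rowSum lam (x + 1) * colSum lam (x + 1)) := by
  rw [jucysMurphy, Finset.mul_sum, Finset.sum_mul,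
    Finset.sum_congr rfl fun y hy => rowSum_mul_swap_mul_colSum (Finset.mem_Iio.1 hy),
    ← Finset.sum_smul, Finset.sum_sub_distrib, Finset.sum_boole, Finset.sum_boole,
    card_filter_row_eq, card_filter_col_eq, content, Int.cast_sub, Int.cast_natCast,
    Int.cast_natCast]

theorem prod_filter_val_lt_succ {M : Type*} [CommMonoid M] (f : Fin d → M) (x : Fin d) :
    ∏ i with i.val < x.val + 1, f i = (∏ i with i.val < x.val, f i) * f x := by
  have hinsert : ({i : Fin d | i.val < x.val + 1} : Finset (Fin d)) =
      insert x ({i | i.val < x.val} : Finset (Fin d)) := by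
    ext i
    simp only [Finset.mem_insert, Finset.mem_filter_univ, Fin.ext_iff]
    lia
  rw [hinsert, Finset.prod_insert (by simp), mul_comm]

theorem rowSum_mul_cycleSum_mul_colSum (z : ℂ) {k : ℕ} (hk : k ≤ d) :
    rowSum lam k * cycleSum d z k * colSum lam k =
      (∏ i : Fin d with i.val < k, (z + content (tableau lam i))) •
        (rowSum lam k * colSum lam k) := by
  induction k with
  | zero => simp [cycleSum_zero]
  | succ k ih =>
    obtain ⟨x, rfl⟩ : ∃ x : Fin d, (x : ℕ) = k := ⟨⟨k, hk⟩, rfl⟩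
    obtain ⟨u, hu⟩ : ∃ u, u * rowSum lam x = rowSum lam (x + 1) :=
      exists_mul_charSum_eq _ _ (youngSubgroup_mono _ (Nat.le_succ _))
    obtain ⟨v, hv⟩ : ∃ v, colSum lam x * v = colSum lam (x + 1) :=
      exists_charSum_mul_eq _ _ (youngSubgroup_mono _ (Nat.le_succ _))
    set J : ℂ[Perm (Fin d)] := z • 1 + jucysMurphy x with hJ
    have hcomm : rowSum lam x * J = J * rowSum lam x :=
      (((Commute.one_right _).smul_right z).add_right (charSum_commute_jucysMurphy _ _ x)).eq
    calc rowSum lam (x + 1) * cycleSum d z (x + 1) * colSum lam (x + 1)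
        = u * (rowSum lam x * J) * cycleSum d z x * (colSum lam x * v) := by
          rw [cycleSum_succ, ← hJ, ← hu, hv]
          simp only [mul_assoc]
      _ = u * J * (rowSum lam x * cycleSum d z x * colSum lam x) * v := by
          rw [hcomm]
          simp only [mul_assoc]
      _ = (∏ i : Fin d with i.val < x.val, (z + content (tableau lam i))) •
            (u * (J * rowSum lam x) * (colSum lam x * v)) := by
          rw [ih x.2.le]
          simp only [mul_assoc, mul_smul_comm, smul_mul_assoc]
      _ = _ := by
          rw [← hcomm, ← mul_assoc u, hu, hv, hJ, mul_add, add_mul,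
            rowSum_mul_jucysMurphy_mul_colSum, mul_smul_comm, smul_mul_assoc, mul_one,
            ← add_smul, smul_smul, prod_filter_val_lt_succ]

theorem cycleSum_mul_youngSymmetrizer (z : ℂ) (lam : d.Partition) :
    cycleSum d z d * youngSymmetrizer lam =
      (∏ c ∈ (diagram lam).cells, (z + content c)) • youngSymmetrizer lam := by
  have h := rowSum_mul_cycleSum_mul_colSum (lam := lam) z le_rfl
  have htop : ∀ i ∈ (Finset.univ : Finset (Fin d)), (i : ℕ) < d := fun i _ => i.2
  rw [Subalgebra.mem_center_iff.1 (cycleSum_mem_center d z), mul_assoc,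
    ← youngSymmetrizer_eq_rowSum_mul_colSum, Finset.filter_true_of_mem htop,
    ← prod_cells_eq_prod_tableau lam fun c => z + content c] at h
  exact h

end YoungSymmetrizer

/-! ### Separation of partitions by contents -/

section Content

theorem le_of_card_filter_content_le {μ ν : YoungDiagram}
    (h : ∀ k, (μ.cells.filter (content · = k)).card ≤ (ν.cells.filter (content · = k)).card) :
    μ ≤ ν := by
  refine fun c hc => by_contra fun hcν => (h (content c)).not_gt ?_
  refine Finset.card_lt_card (Finset.ssubset_iff_subset_ne.2 ⟨fun b hb => ?_, fun heq => ?_⟩)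
  · obtain ⟨hbν, hbc⟩ := Finset.mem_filter.1 hb
    have hcb : ¬ c ≤ b := fun hcb => hcν (ν.isLowerSet hcb hbν)
    refine Finset.mem_filter.2 ⟨μ.isLowerSet (show b ≤ c from ?_) hc, hbc⟩
    rw [content, content] at hbc
    rw [Prod.le_def] at hcb ⊢
    lia
  · have hcmem : c ∈ μ.cells.filter (content · = content c) := Finset.mem_filter.2 ⟨hc, rfl⟩
    rw [← heq, Finset.mem_filter] at hcmem
    exact hcν hcmem.1

theorem eq_of_prod_add_eq {K : Type*} [CommRing K] [IsDomain K] [Infinite K] {s t : Multiset K}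
    (h : ∀ z, (s.map (z + ·)).prod = (t.map (z + ·)).prod) : s = t := by
  have eval_eq (s : Multiset K) (z : K) :
      (((s.map Neg.neg).map fun a => Polynomial.X - Polynomial.C a).prod).eval z =
        (s.map (z + ·)).prod := by
    simp [Polynomial.eval_multiset_prod, Multiset.map_map]
  refine Multiset.map_injective neg_injective ?_
  rw [← Polynomial.roots_multiset_prod_X_sub_C (s.map Neg.neg),
    ← Polynomial.roots_multiset_prod_X_sub_C (t.map Neg.neg)]
  exact congrArg _ (Polynomial.funext fun z => by rw [eval_eq, eval_eq, h])

theorem diagram_injective {d : ℕ} : Function.Injective (diagram (d := d)) := by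
  intro lam mu h
  have hrowLens (nu : d.Partition) : (diagram nu).rowLens = nu.parts.sort (· ≥ ·) :=
    YoungDiagram.rowLens_ofRowLens_eq_self fun x hx => nu.parts_pos ((Multiset.mem_sort _).1 hx)
  refine Nat.Partition.ext ?_
  rw [← Multiset.sort_eq lam.parts (· ≥ ·), ← hrowLens, h, hrowLens, Multiset.sort_eq]

theorem exists_prod_add_content_ne {d : ℕ} {lam mu : d.Partition} (hne : lam ≠ mu) :
    ∃ z : ℂ, ∏ c ∈ (diagram lam).cells, (z + content c) ≠
      ∏ c ∈ (diagram mu).cells, (z + content c) := by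
  by_contra! h
  have hmap : ((diagram lam).cells.val.map fun c => (content c : ℂ)) =
      (diagram mu).cells.val.map fun c => (content c : ℂ) :=
    eq_of_prod_add_eq fun z => by
      rw [Multiset.map_map, Multiset.map_map]
      exact h z
  have hcard (k : ℤ) : ((diagram lam).cells.filter (content · = k)).card =
      ((diagram mu).cells.filter (content · = k)).card := by
    have hcount := congrArg (Multiset.count (k : ℂ)) hmap
    simp only [Multiset.count_map, Int.cast_inj, eq_comm (a := k)] at hcount
    exact hcount
  exact hne (diagram_injective (le_antisymm (le_of_card_filter_content_le fun k => (hcard k).le)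
    (le_of_card_filter_content_le fun k => (hcard k).ge)))

theorem youngSymmetrizer_mul_mul_youngSymmetrizer_of_ne {d : ℕ} {lam mu : d.Partition}
    (hne : lam ≠ mu) (x : ℂ[Equiv.Perm (Fin d)]) :
    youngSymmetrizer lam * x * youngSymmetrizer mu = 0 := by
  obtain ⟨z, hz⟩ := exists_prod_add_content_ne hne
  exact mul_mul_eq_zero_of_mem_center (cycleSum_mem_center d z)
    (cycleSum_mul_youngSymmetrizer z lam) (cycleSum_mul_youngSymmetrizer z mu) hz x

end Content

/-! ### Quasi-idempotence of the Young symmetrizers -/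

theorem sum_range_card_le_sum (s : Finset ℕ) : ∑ i ∈ Finset.range s.card, i ≤ ∑ i ∈ s, i := by
  induction s using Finset.induction_on_max with
  | empty => rfl
  | insert a s hlt ih =>
    have hnotMem : a ∉ s := fun ha => (hlt a ha).false
    have hcard : s.card ≤ a := by
      simpa using Finset.card_le_card fun i hi => Finset.mem_range.2 (hlt i hi)
    rw [Finset.card_insert_of_notMem hnotMem, Finset.sum_range_succ, Finset.sum_insert hnotMem,
      add_comm]
    exact add_le_add hcard ih

theorem eq_range_of_sum_le {s : Finset ℕ} (h : ∑ i ∈ s, i ≤ ∑ i ∈ Finset.range s.card, i) :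
    s = Finset.range s.card := by
  induction s using Finset.induction_on_max with
  | empty => rfl
  | insert a s hlt ih =>
    have hnotMem : a ∉ s := fun ha => (hlt a ha).false
    have hcard : s.card ≤ a := by
      simpa using Finset.card_le_card fun i hi => Finset.mem_range.2 (hlt i hi)
    rw [Finset.card_insert_of_notMem hnotMem] at h ⊢
    rw [Finset.sum_range_succ, Finset.sum_insert hnotMem] at h
    have hs := ih (by lia)
    have ha : a = s.card := by
      have := sum_range_card_le_sum s
      lia
    rw [Finset.range_add_one, ← hs, ← ha]

section Decomposition

open Equiv Equiv.Perm

variable {d : ℕ} {lam : d.Partition} {σ : Perm (Fin d)}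

theorem image_row_filter_col_eq (lam : d.Partition) (j : ℕ) :
    Finset.image (fun x => (tableau lam x).1) {x | (tableau lam x).2 = j} =
      Finset.range ((diagram lam).colLen j) := by
  ext i
  rw [Finset.mem_range, ← YoungDiagram.mem_iff_lt_colLen, Finset.mem_image]
  refine ⟨fun ⟨x, hx, hi⟩ => ?_, fun hi => ?_⟩
  · rw [← hi, ← (Finset.mem_filter_univ x).1 hx]
    exact tableau_mem lam x
  · obtain ⟨x, hx⟩ := exists_tableau_eq hi
    exact ⟨x, by simp [hx], by rw [hx]⟩

theorem injOn_row_of_injective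
    (hσ : Function.Injective fun x => ((tableau lam (σ x)).1, (tableau lam x).2)) (j : ℕ) :
    Set.InjOn (fun x => (tableau lam (σ x)).1)
      (({x | (tableau lam x).2 = j} : Finset (Fin d)) : Set (Fin d)) := by
  intro x hx y hy h
  rw [Finset.mem_coe, Finset.mem_filter_univ] at hx hy
  exact hσ (Prod.ext h (hx.trans hy.symm))

theorem card_filter_col (lam : d.Partition) (j : ℕ) :
    (Finset.univ.filter fun x => (tableau lam x).2 = j).card = (diagram lam).colLen j := by
  rw [← Finset.card_range ((diagram lam).colLen j), ← image_row_filter_col_eq]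
  exact (Finset.card_image_of_injOn
    (injOn_row_of_injective (σ := 1) (tableau_injective lam) j)).symm

-- The rows of `σ x`, for `x` in a given column, are distinct, so their sum is least when they form
-- an initial segment. Over all columns these sums add up to the same total as for `σ = 1`.
theorem mem_diagram_of_injective
    (hσ : Function.Injective fun x => ((tableau lam (σ x)).1, (tableau lam x).2)) (x : Fin d) :
    ((tableau lam (σ x)).1, (tableau lam x).2) ∈ diagram lam := by
  let col (j : ℕ) : Finset (Fin d) := {x | (tableau lam x).2 = j}
  let rows (j : ℕ) : Finset ℕ := (col j).image fun x => (tableau lam (σ x)).1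
  let cols := Finset.univ.image fun x => (tableau lam x).2
  have card_rows (j : ℕ) : (rows j).card = (diagram lam).colLen j := by
    rw [Finset.card_image_of_injOn (injOn_row_of_injective hσ j), card_filter_col]
  have maps_to : ∀ x ∈ (Finset.univ : Finset (Fin d)), (tableau lam x).2 ∈ cols :=
    fun x hx => Finset.mem_image_of_mem _ hx
  have sum_eq : ∑ j ∈ cols, ∑ i ∈ Finset.range (rows j).card, i =
      ∑ j ∈ cols, ∑ i ∈ rows j, i :=
    calc _ = ∑ j ∈ cols, ∑ x ∈ col j, (tableau lam x).1 := by
          refine Finset.sum_congr rfl fun j _ => ?_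
          rw [card_rows, ← image_row_filter_col_eq, Finset.sum_image]
          exact injOn_row_of_injective (σ := 1) (tableau_injective lam) j
      _ = ∑ x, (tableau lam (σ x)).1 := by
          rw [Finset.sum_fiberwise_of_maps_to maps_to, Equiv.sum_comp σ fun x => (tableau lam x).1]
      _ = _ := by
          rw [← Finset.sum_fiberwise_of_maps_to maps_to]
          exact Finset.sum_congr rfl fun j _ =>
            (Finset.sum_image (f := id) (injOn_row_of_injective hσ j)).symm
  have rows_eq : rows (tableau lam x).2 = Finset.range (rows (tableau lam x).2).card :=
    eq_range_of_sum_le ((Finset.sum_eq_sum_iff_of_le fun j _ => sum_range_card_le_sum (rows j)).1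
      sum_eq _ (maps_to x (Finset.mem_univ x))).ge
  rw [YoungDiagram.mem_iff_lt_colLen, ← card_rows, ← Finset.mem_range, ← rows_eq]
  exact Finset.mem_image_of_mem _ ((Finset.mem_filter_univ x).2 rfl)

theorem exists_eq_mul_of_injective
    (hσ : Function.Injective fun x => ((tableau lam (σ x)).1, (tableau lam x).2)) :
    ∃ p ∈ youngSubgroup (fun i => (tableau lam i).1) d,
      ∃ q ∈ youngSubgroup (fun i => (tableau lam i).2) d, σ = p * q := by
  choose v hv using fun x => exists_tableau_eq (mem_diagram_of_injective hσ x)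
  have hinj : Function.Injective v := fun x y hxy =>
    hσ ((hv x).symm.trans ((congrArg _ hxy).trans (hv y)))
  let q : Perm (Fin d) := Equiv.ofBijective v (Finite.injective_iff_bijective.1 hinj)
  have hq (x : Fin d) : tableau lam (q x) = ((tableau lam (σ x)).1, (tableau lam x).2) := hv x
  refine ⟨σ * q⁻¹, mem_youngSubgroup_self.2 fun x => ?_, q, mem_youngSubgroup_self.2 fun x => ?_,
    (inv_mul_cancel_right σ q).symm⟩
  · have h := congrArg Prod.fst (hq (q⁻¹ x))
    rw [← Perm.mul_apply q, mul_inv_cancel, Perm.one_apply] at h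
    exact h.symm
  · rw [hq]

theorem rowSum_mul_single_mul_colSum (lam : d.Partition) (σ : Perm (Fin d)) :
    ∃ a : ℂ, rowSum lam d * single σ 1 * colSum lam d = a • youngSymmetrizer lam := by
  rw [youngSymmetrizer_eq_rowSum_mul_colSum]
  by_cases hσ : Function.Injective fun x => ((tableau lam (σ x)).1, (tableau lam x).2)
  · obtain ⟨p, hp, q, hq, rfl⟩ := exists_eq_mul_of_injective hσ
    have hsingle : single (p * q) (1 : ℂ) =
        signChar (Fin d) q⁻¹ • (single p 1 * single q (signChar (Fin d) q)) := by
      rw [single_mul_single, one_mul, smul_single, smul_eq_mul, ← map_mul, inv_mul_cancel, map_one]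
    exact ⟨signChar (Fin d) q⁻¹, by
      rw [hsingle, mul_smul_comm, smul_mul_assoc, ← mul_assoc, rowSum_mul_single hp, mul_assoc,
        single_mul_colSum hq]⟩
  · obtain ⟨x, y, hxy, hne⟩ : ∃ x y, ((tableau lam (σ x)).1, (tableau lam x).2) =
        ((tableau lam (σ y)).1, (tableau lam y).2) ∧ x ≠ y := by
      simpa only [Function.Injective, not_forall, exists_prop] using hσ
    exact ⟨0, by
      rw [zero_smul, rowSum_mul_single_mul_colSum_eq_zero hne x.2 y.2 (σ x).2 (σ y).2
        (Prod.ext_iff.1 hxy).1 (Prod.ext_iff.1 hxy).2]⟩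

theorem disjoint_youngSubgroup_row_col (lam : d.Partition) :
    Disjoint (youngSubgroup (fun i => (tableau lam i).1) d)
      (youngSubgroup (fun i => (tableau lam i).2) d) :=
  Subgroup.disjoint_def.2 fun hrow hcol =>
    Equiv.ext fun i => tableau_injective lam (Prod.ext (hrow.1 i) (hcol.1 i))

theorem isPrimitiveUpToScalar_youngSymmetrizer (lam : d.Partition) :
    IsPrimitiveUpToScalar (youngSymmetrizer lam) where
  coeff_one := by
    rw [youngSymmetrizer_eq_rowSum_mul_colSum]
    exact coeff_charSum_mul_charSum_one _ _ _ (disjoint_youngSubgroup_row_col lam)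
  exists_smul x := by
    obtain ⟨a, ha⟩ := exists_mul_mul_eq_smul_of_single (rowSum_mul_single_mul_colSum lam)
      (colSum lam d * x * rowSum lam d)
    refine ⟨a, ?_⟩
    rw [← ha, youngSymmetrizer_eq_rowSum_mul_colSum]
    simp only [mul_assoc]

end Decomposition

/-! ### The Weingarten matrix -/

section WeingartenMatrix

variable {H : Type*} [NormedAddCommGroup H] [InnerProductSpace ℂ H] {N d : ℕ}

theorem exists_mem_center_gramMatrix_mul_eq_one (e : OrthonormalBasis (Fin N) ℂ H) (hd : d ≤ N) :
    ∃ w ∈ Subalgebra.center ℂ ℂ[Equiv.Perm (Fin d)],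
      gramMatrix e d * coeffMatrix w = 1 ∧ ∀ π, w.coeff π =
        ∑ lam : d.Partition, irrepChar lam π /
          (∏ c ∈ (diagram lam).cells, ((N : ℂ) + (content c : ℂ))) *
            ((irrepDim lam : ℂ) / (d.factorial : ℂ)) := by
  obtain ⟨w, hw, hmul, hcoeff⟩ := exists_mul_eq_one_of_mul_eq_smul
    isPrimitiveUpToScalar_youngSymmetrizer
    (fun _ _ => youngSymmetrizer_mul_mul_youngSymmetrizer_of_ne)
    (card_conjClasses_perm_le d) (cycleSum_mem_center d (N : ℂ))
    (fun lam => prod_add_content_ne_zero (lam := lam) hd)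
    (cycleSum_mul_youngSymmetrizer (N : ℂ))
  refine ⟨w, hw, ?_, fun π => ?_⟩
  · rw [gramMatrix_eq_coeffMatrix, ← coeffMatrix_mul, hmul, coeffMatrix_one]
  · have hinv : IsConj π π⁻¹ := by
      rw [Equiv.Perm.isConj_iff_cycleType_eq, Equiv.Perm.cycleType_inv]
    rw [mem_center_iff_coeff_eq_of_isConj.1 hw _ _ hinv, hcoeff, Nat.card_eq_fintype_card,
      Fintype.card_perm, Fintype.card_fin]
    rfl

end WeingartenMatrix

end Weingarten

end

theorem theorem4p3 {H : Type*} [NormedAddCommGroup H] [InnerProductSpace ℂ H] {N d : ℕ}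
    (e : OrthonormalBasis (Fin N) ℂ H) (hd : d ≤ N) :
    Weingarten.gramMatrix e d =
        Matrix.of (fun ρ σ : Equiv.Perm (Fin d) => (N : ℂ) ^ Weingarten.numCycles (ρ⁻¹ * σ)) ∧
    Weingarten.weingartenMatrix e d * Weingarten.gramMatrix e d = 1 ∧
    Weingarten.gramMatrix e d * Weingarten.weingartenMatrix e d = 1 ∧
    (∀ ρ σ : Equiv.Perm (Fin d),
      Weingarten.weingartenMatrix e d ρ σ =
        ∑ lam : d.Partition,
          Weingarten.irrepChar lam (ρ⁻¹ * σ) /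
              (∏ c ∈ (Weingarten.diagram lam).cells, ((N : ℂ) + (Weingarten.content c : ℂ))) *
            ((Weingarten.irrepDim lam : ℂ) / (d.factorial : ℂ))) ∧
    ∃! Wg : d.Partition → ℂ, ∀ ρ σ : Equiv.Perm (Fin d),
      Weingarten.weingartenMatrix e d ρ σ = Wg (Weingarten.cycleTypePartition (ρ⁻¹ * σ)) := by
  obtain ⟨w, hw, hmul, hcoeff⟩ := Weingarten.exists_mem_center_gramMatrix_mul_eq_one e hd
  have hW : Weingarten.weingartenMatrix e d = Weingarten.coeffMatrix w :=
    Matrix.inv_eq_right_inv hmul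
  refine ⟨Matrix.ext (Weingarten.gramMatrix_apply e), ?_, ?_, fun ρ σ => ?_, ?_⟩
  · rw [hW, mul_eq_one_comm, hmul]
  · rw [hW, hmul]
  · rw [hW, ← hcoeff]
    rfl
  · obtain ⟨Wg, hWg, unique⟩ := Weingarten.existsUnique_eq_comp_cycleTypePartition
      (Weingarten.mem_center_iff_coeff_eq_of_isConj.1 hw)
    refine ⟨Wg, fun ρ σ => ?_, fun f hf => unique f (funext fun π => ?_)⟩
    · rw [hW]
      exact congrFun hWg (ρ⁻¹ * σ)
    · have hπ := hf 1 π
      rwa [hW, inv_one, one_mul, Weingarten.coeffMatrix, Matrix.of_apply, inv_one, one_mul] at hπ
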